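/- **Setting.** Let $G$ be a graph. A *leveled path collection* of size $n$ in $G$ is a family $P=(p_1,\dots,p_n)$ of paths in $G$ such that every node $v$ can be given a level $l(v)\in\mathbb N$ with $l(w)=l(v)+1$ for every edge $(v,w)$ of a path in $P$. Along each path $p_i$ one packet has to be routed. Each packet belongs to one of $N$ aggregation groups $1,\dots,N$, and packets of the same group have the same destination. Let $E(P)$ be the set of all (directed) edges used by the paths of $P$. The *congestion* $C$ is the maximum number of aggregation groups that have packets whose paths cross the same edge; the *depth* $D$ is the maximum length of a directed path consisting of edges of $E(P)$ (it is at most the difference between the largest and the smallest level of any leveling); the *degree* $d$ is the maximum number of edges in $E(P)$ leading to the same node. (Maxima over the empty set are $0$.) **Protocol.** Let $K\ge 1$ be an integer and let $\rho:\{1,\dots,N\}\to\{0,\dots,K-1\}$ be a uniformly random function; all packets of group $a$ have rank $\rho(a)$. Initially, every packet is stored at the first node of its path. In every synchronous step, first, at every node, all packets stored there that belong to the same group are combined into a single packet of this group, which continues along the remaining path of one of them (the choice is arbitrary, and may even be made by an adversary who knows $\rho$). Then, for every edge, among the packets that have to cross this edge next, the one of smallest rank (in case of a tie, of smallest group identifier)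 crosses the edge, and all others are delayed. Routing is finished when all (combined) packets have reached their destinations. **Theorem.** For every constant $c>0$ there is a constant $B>0$, depending only on $c$, such that for every leveled path collection $P$ of size $n$ with congestion $C$, depth $D$ and degree $d$ (in any graph and with any assignment to aggregation groups), and for every integer $K\ge 1$ with $K\ge 8C$, with probability at least $1-1/n^{c}$ (read as $1$ if $n=0$) over the choice of $\rho$, whatever choices are made when packets are combined, routing in $P$ finishes within at most $$B\,\bigl(C+D\log\max\{d,2\}+\log n\bigr)$$ steps (the term $\log n$ is read as $0$ if $n=0$). In particular, for $d\ge 2$ the protocol needs $O(C+D\log d+\log n)$ steps, with high probability. -/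

import Mathlib

/-- A leveled path collection of size `n` in the graph `G`, together with the assignment of its
`n` packets to `N` aggregation groups. Packet `i` has to travel along the walk `path i`; all packets
of one aggregation group `a` have the same destination `target a`. Every node can be given a level
so that every edge `(v, w)` of a path of the collection leads from its level to the next one. -/
structure LeveledPathCollection {V : Type*} (G : SimpleGraph V) (n N : ℕ) where
  /-- the aggregation group of a packet -/
  group : Fin n → Fin N
  /-- the source of a packet -/
  source : Fin n → V
  /-- the common destination of the packets of an aggregation group -/
  target : Fin N → V
  /-- the path of a packet -/
  path : (i : Fin n) → G.Walk (source i) (target (group i))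
  /-- the collection is leveled -/
  leveled : ∃ l : V → ℕ, ∀ i : Fin n, ∀ k < (path i).length,
    l ((path i).getVert (k + 1)) = l ((path i).getVert k) + 1

/-- The rule that tells which of the packets that are being combined lends its remaining path to
the combined packet: in round `t`, the packets of the nonempty set `S` are combined into the packet
`keep t S`, which is one of them. -/
structure CombineRule (n : ℕ) where
  keep : ℕ → Finset (Fin n) → Fin n
  keep_mem : ∀ (t : ℕ) (S : Finset (Fin n)), S.Nonempty → keep t S ∈ S

/-- A configuration of the routing protocol: the packets that are still present (that is, that have
not been merged into another packet), and the number of edges a packet has crossed so far. -/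
structure RoutingState (n : ℕ) where
  alive : Finset (Fin n)
  pos : Fin n → ℕ

namespace LeveledPathCollection

variable {V : Type*} {G : SimpleGraph V} {n N : ℕ}

/-- The `k`-th (directed) edge on the path of packet `i`, for `k < (P.path i).length`. -/
def edgeAt (P : LeveledPathCollection G n N) (i : Fin n) (k : ℕ) : V × V :=
  ((P.path i).getVert k, (P.path i).getVert (k + 1))

section Parameters

variable [DecidableEq V]

/-- The set of the (directed) edges of the path of packet `i`. -/
def pathEdges (P : LeveledPathCollection G n N) (i : Fin n) : Finset (V × V) :=
  (Finset.range (P.path i).length).image (P.edgeAt i)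

/-- The set `E(P)` of all edges used by the paths of the collection. -/
def edges (P : LeveledPathCollection G n N) : Finset (V × V) :=
  Finset.univ.biUnion P.pathEdges

/-- The congestion: the maximum number of aggregation groups that have packets that want to cross
the same edge. -/
def congestion (P : LeveledPathCollection G n N) : ℕ :=
  P.edges.sup fun e => ((Finset.univ.filter fun i => e ∈ P.pathEdges i).image P.group).card

/-- The degree: the maximum number of edges in `E(P)` leading to the same node. -/
def degree (P : LeveledPathCollection G n N) : ℕ :=
  P.edges.sup fun e => (P.edges.filter fun e' => e'.2 = e.2).card

/-- The lengths of the directed paths that consist of edges of `E(P)`. -/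
def directedPathLengths (P : LeveledPathCollection G n N) : Set ℕ :=
  {k | ∃ v : ℕ → V, ∀ j < k, (v j, v (j + 1)) ∈ P.edges}

/-- The depth: the maximum length of a directed path that consists of edges of `E(P)`. (Such a path
may be put together from parts of several paths of the collection.) -/
noncomputable def depth (P : LeveledPathCollection G n N) : ℕ :=
  sSup P.directedPathLengths

/-- The lengths in the definition of the depth are bounded by the span of any level function. -/
theorem mem_directedPathLengths_le (P : LeveledPathCollection G n N) (l : V → ℕ) (D : ℕ)
    (hl : ∀ i : Fin n, ∀ k < (P.path i).length,
      l ((P.path i).getVert (k + 1)) = l ((P.path i).getVert k) + 1)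
    (hD : ∀ e ∈ P.edges, l e.2 ≤ D) {k : ℕ} (hk : k ∈ P.directedPathLengths) : k ≤ D := by
  obtain ⟨v, hv⟩ := hk
  have step : ∀ j < k, l (v (j + 1)) = l (v j) + 1 := by
    intro j hj
    have h := hv j hj
    simp only [edges, pathEdges, Finset.mem_biUnion, Finset.mem_univ, true_and, Finset.mem_image,
      Finset.mem_range, edgeAt, Prod.mk.injEq] at h
    obtain ⟨i, m, hm, h1, h2⟩ := h
    rw [← h1, ← h2]
    exact hl i m hm
  have lev : ∀ j ≤ k, j ≤ l (v j) := by
    intro j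
    induction j with
    | zero => intro _; exact Nat.zero_le _
    | succ j ih =>
      intro hj
      have h1 := ih (by omega)
      have h2 := step j (by omega)
      omega
  rcases Nat.eq_zero_or_pos k with h0 | hpos
  · omega
  · obtain ⟨m, rfl⟩ : ∃ m, k = m + 1 := ⟨k - 1, by omega⟩
    exact (lev _ le_rfl).trans (hD _ (hv m (by omega)))

/-- The supremum that defines the depth is a maximum over a bounded set. -/
theorem bddAbove_directedPathLengths (P : LeveledPathCollection G n N) :
    BddAbove P.directedPathLengths := by
  obtain ⟨l, hl⟩ := P.leveled
  exact ⟨P.edges.sup fun e => l e.2, fun k hk => P.mem_directedPathLengths_le l _ hl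
    (fun e he => Finset.le_sup (f := fun e : V × V => l e.2) he) hk⟩

end Parameters

section Protocol

/-- The node at which packet `i` is stored in the configuration `s`. -/
def node (P : LeveledPathCollection G n N) (s : RoutingState n) (i : Fin n) : V :=
  (P.path i).getVert (s.pos i)

/-- At the start, every packet is present and is stored at its source. -/
def start (n : ℕ) : RoutingState n where
  alive := Finset.univ
  pos := fun _ => 0

variable [DecidableEq V]

/-- Combining: at every node, the packets that belong to the same aggregation group are combined
into a single packet. -/
def combine (P : LeveledPathCollection G n N) (R : CombineRule n) (t : ℕ)
    (s : RoutingState n) : RoutingState n where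
  alive := s.alive.filter fun i =>
    i = R.keep t (s.alive.filter fun j => P.group j = P.group i ∧ P.node s j = P.node s i)
  pos := s.pos

/-- Packet `i` is present and wants to cross the edge `e` next. -/
def Wants (P : LeveledPathCollection G n N) (s : RoutingState n) (i : Fin n) (e : V × V) : Prop :=
  i ∈ s.alive ∧ s.pos i < (P.path i).length ∧ P.edgeAt i (s.pos i) = e

instance (P : LeveledPathCollection G n N) (s : RoutingState n) (i : Fin n) (e : V × V) :
    Decidable (P.Wants s i e) := by
  unfold Wants; infer_instance

/-- Packet `i` wins the contention for its next edge: among all packets that want to cross that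
edge it has the smallest rank, ties between ranks being broken by the smallest group identifier. -/
def Wins (P : LeveledPathCollection G n N) {K : ℕ} (ρ : Fin N → Fin K) (s : RoutingState n)
    (i : Fin n) : Prop :=
  P.Wants s i (P.edgeAt i (s.pos i)) ∧
    ∀ j : Fin n, P.Wants s j (P.edgeAt i (s.pos i)) →
      ρ (P.group i) < ρ (P.group j) ∨
        (ρ (P.group i) = ρ (P.group j) ∧ P.group i ≤ P.group j)

instance (P : LeveledPathCollection G n N) {K : ℕ} (ρ : Fin N → Fin K) (s : RoutingState n)
    (i : Fin n) : Decidable (P.Wins ρ s i) := by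
  unfold Wins; infer_instance

/-- Forwarding: every packet that wins the contention for its next edge crosses this edge, and all
other packets stay where they are. -/
def forward (P : LeveledPathCollection G n N) {K : ℕ} (ρ : Fin N → Fin K)
    (s : RoutingState n) : RoutingState n where
  alive := s.alive
  pos := fun i => if P.Wins ρ s i then s.pos i + 1 else s.pos i

/-- The configuration after `t` steps, where `ρ a` is the rank of all packets of group `a`. -/
def run (P : LeveledPathCollection G n N) {K : ℕ} (ρ : Fin N → Fin K) (R : CombineRule n) :
    ℕ → RoutingState n
  | 0 => start n
  | t + 1 => P.forward ρ (P.combine R t (P.run ρ R t))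

/-- Routing is finished: all present packets have reached their destination. -/
def Finished (P : LeveledPathCollection G n N) (s : RoutingState n) : Prop :=
  ∀ i ∈ s.alive, s.pos i = (P.path i).length

end Protocol

end LeveledPathCollection

/-!
The bound is a delay sequence argument. Suppose that routing is not finished after `t + 1` steps.
Then some packet crosses an edge in the last of these steps, and its history can be traced backward
one step at a time. If the traced packet crossed an edge in the preceding step, the trace moves on
to that edge; if it was delayed in front of its edge, the trace switches to the packet that crossed
this edge instead, whose group has a strictly smaller priority (`exists_delaySequence`). Combining
does no harm: a packet that is present now was present at all earlier times, on its own path.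

The edges visited by the trace form a directed path in `E(P)`, so at most `D` of the `t` steps are
moves and all others are delays (`add_le_length_add_depth`). The delaying groups form a list along
which the priorities strictly decrease. In particular these groups are distinct and their ranks
weakly decrease, which for a fixed list of length `s` has probability at most
`multichoose K s / K ^ s ≤ exp (8 * C) / (4 * C) ^ s`.

There are at most `d` choices for a move and at most `C` choices for a delaying group, so that the
lists `l` obtained from a given last edge satisfy `∑ l, (d / C) ^ l.length ≤ (2 * d) ^ t`
(`sum_delaySequences_le`). Since `t - D ≤ l.length`, a union bound over the lists and over the at
most `n * D` last edges shows that routing takes more than `t + 1` steps with probability at most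
`n * D * exp (8 * C) * (4 * d) ^ D / 2 ^ t` (`uniformOn_not_finished_le`), where `d` is replaced by
`max d 2`. For `t` of the order `C + D * log d + log n` this is at most `1 / n ^ c`.
-/

/-! ### Sums and multiset coefficients -/

theorem sum_biUnion_le_sum_sum {ι α : Type*} [DecidableEq α] (s : Finset ι)
    (t : ι → Finset α) {f : α → ℝ} (hf : ∀ a, 0 ≤ f a) :
    ∑ a ∈ s.biUnion t, f a ≤ ∑ i ∈ s, ∑ a ∈ t i, f a := by
  classical
  induction s using Finset.induction_on with
  | empty => simp
  | insert i s hi ih =>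
    rw [Finset.biUnion_insert, Finset.sum_insert hi]
    exact (le_add_of_nonneg_right (Finset.sum_nonneg fun a _ => hf a)).trans
      (Finset.sum_union_inter.trans_le (add_le_add_right ih _))

/-- One term of the expansion `∑ s, multichoose K s * x ^ s = (1 - x)⁻¹ ^ K`, multiplied out so that
`x = 1` needs no exception. -/
theorem multichoose_mul_pow_le_one {x : ℝ} (hx0 : 0 ≤ x) (hx1 : x ≤ 1) (K s : ℕ) :
    (K.multichoose s : ℝ) * x ^ s * (1 - x) ^ K ≤ 1 := by
  have hy : 0 ≤ 1 - x := by linarith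
  induction K generalizing s with
  | zero =>
    cases s with
    | zero => simp
    | succ s => simp
  | succ K ihK =>
    induction s with
    | zero => simpa using pow_le_one₀ (n := K + 1) hy (by linarith)
    | succ s ihs =>
      rw [Nat.multichoose_succ_succ]
      push_cast
      calc ((K.multichoose (s + 1) : ℝ) + ((K + 1).multichoose s : ℝ)) * x ^ (s + 1)
            * (1 - x) ^ (K + 1)
          = (1 - x) * ((K.multichoose (s + 1) : ℝ) * x ^ (s + 1) * (1 - x) ^ K)
            + x * (((K + 1).multichoose s : ℝ) * x ^ s * (1 - x) ^ (K + 1)) := by ring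
        _ ≤ (1 - x) * 1 + x * 1 := by gcongr; exact ihK (s + 1)
        _ = 1 := by ring

/-- At most the fraction `multichoose K s / K ^ s` of all functions into `Fin K` is weakly decreasing
along a list of `s` distinct elements: such a function is determined by the multiset of its values
on the list and by its restriction to the complement of the list. -/
theorem card_pairwise_le {α : Type*} [Fintype α] [DecidableEq α] {K : ℕ} (l : List α)
    (hl : l.Nodup) :
    Nat.card {ρ : α → Fin K // l.Pairwise fun a b => ρ b ≤ ρ a} * K ^ l.length ≤
      K.multichoose l.length * K ^ Fintype.card α := by
  let Φ : {ρ : α → Fin K // l.Pairwise fun a b => ρ b ≤ ρ a} →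
      Sym (Fin K) l.length × ({a : α // a ∉ l} → Fin K) :=
    fun ρ => (⟨(l.map ρ.1 : Multiset (Fin K)), by simp⟩, fun a => ρ.1 a)
  have hΦ : Function.Injective Φ := by
    rintro ⟨ρ, hρ⟩ ⟨σ, hσ⟩ h
    have h1 : (l.map ρ).Perm (l.map σ) :=
      Multiset.coe_eq_coe.1 (congrArg (fun p => (p.1 : Multiset (Fin K))) h)
    have h2 : (fun a : {a : α // a ∉ l} => ρ a) = fun a : {a : α // a ∉ l} => σ a :=
      congrArg Prod.snd h
    have h3 : l.map ρ = l.map σ :=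
      h1.eq_of_pairwise (le := fun a b => b ≤ a) (fun a b _ _ hab hba => le_antisymm hba hab)
        (List.pairwise_map.2 hρ) (List.pairwise_map.2 hσ)
    ext a : 2
    by_cases ha : a ∈ l
    · exact List.map_inj_left.1 h3 a ha
    · exact congrFun h2 ⟨a, ha⟩
  have hc := Nat.card_le_card_of_injective Φ hΦ
  have hlen : l.length ≤ Fintype.card α := hl.length_le_card
  have hcompl : Fintype.card {a : α // a ∉ l} = Fintype.card α - l.length := by
    have h := Fintype.card_subtype_compl (fun a => a ∈ l)
    rw [h, Fintype.card_of_subtype l.toFinset (by simp), List.toFinset_card_of_nodup hl]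
  rw [Nat.card_prod, Nat.card_eq_fintype_card (α := Sym _ _), Sym.card_sym_eq_multichoose,
    Nat.card_eq_fintype_card (α := _ → _), Fintype.card_fun, hcompl, Fintype.card_fin] at hc
  calc _ ≤ K.multichoose l.length * K ^ (Fintype.card α - l.length) * K ^ l.length := by gcongr
    _ = _ := by rw [mul_assoc, ← pow_add, Nat.sub_add_cancel hlen]

/-! ### The probability of a decreasing list of priorities -/

/-- The priority of an aggregation group: a packet of smaller priority wins the contention for an
edge. Groups are compared by rank first and by identifier second, so that different groups never
have the same priority. -/
abbrev priority {N K : ℕ} (ρ : Fin N → Fin K) (a : Fin N) : Fin K ×ₗ Fin N := toLex (ρ a, a)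

theorem isProbabilityMeasure_uniformOn_ranks {N K : ℕ} (hK : 0 < K) :
    MeasureTheory.IsProbabilityMeasure
      (ProbabilityTheory.uniformOn (Set.univ : Set (Fin N → Fin K))) :=
  have : Nonempty (Fin K) := ⟨⟨0, hK⟩⟩
  ProbabilityTheory.isProbabilityMeasure_uniformOn Set.finite_univ Set.univ_nonempty

/-- The list need not be free of repetitions: strictly decreasing priorities enforce this. -/
theorem uniformOn_univ_real_pairwise_le {N K : ℕ} (hK : 0 < K) (l : List (Fin N)) :
    (ProbabilityTheory.uniformOn (Set.univ : Set (Fin N → Fin K))).real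
        {ρ | l.Pairwise fun a b => priority ρ b < priority ρ a} ≤
      (K.multichoose l.length : ℝ) / (K : ℝ) ^ l.length := by
  have hK' : (0 : ℝ) < K := by exact_mod_cast hK
  by_cases hl : l.Nodup
  · have hsub : {ρ : Fin N → Fin K | l.Pairwise fun a b => priority ρ b < priority ρ a} ⊆
        {ρ | l.Pairwise fun a b => ρ b ≤ ρ a} := by
      intro ρ hρ
      refine List.Pairwise.imp (fun {a b} hab => ?_) hρ
      rcases Prod.Lex.toLex_lt_toLex.1 hab with h | h
      · exact h.le
      · exact h.1.le
    have := isProbabilityMeasure_uniformOn_ranks (N := N) hK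
    refine (MeasureTheory.measureReal_mono hsub).trans ?_
    have hcard := card_pairwise_le (K := K) l hl
    rw [Fintype.card_fin] at hcard
    have hcard' : ((Nat.card {ρ : Fin N → Fin K // l.Pairwise fun a b => ρ b ≤ ρ a} : ℕ) : ℝ) *
        (K : ℝ) ^ l.length ≤ K.multichoose l.length * (K : ℝ) ^ N := by exact_mod_cast hcard
    rw [MeasureTheory.Measure.real, ProbabilityTheory.uniformOn_univ,
      MeasureTheory.Measure.count_apply (Set.toFinite _).measurableSet,
      (Set.toFinite _).encard_eq_coe, ENNReal.toReal_div]
    simp only [Fintype.card_fun, Fintype.card_fin, Nat.cast_pow, ENNReal.toReal_pow,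
      ENNReal.toReal_natCast]
    rw [div_le_div_iff₀ (by positivity) (by positivity)]
    exact hcard'
  · have hempty : {ρ : Fin N → Fin K |
        l.Pairwise fun a b => priority ρ b < priority ρ a} = ∅ := by
      refine Set.eq_empty_of_forall_notMem fun ρ hρ => hl ?_
      refine List.Pairwise.imp (fun {a b} hab => ?_) hρ
      rintro rfl
      exact lt_irrefl _ hab
    rw [hempty, MeasureTheory.measureReal_empty]
    positivity

theorem multichoose_div_pow_le {C K : ℕ} (hC : 0 < C) (hCK : 8 * C ≤ K) (s : ℕ) :
    (K.multichoose s : ℝ) / (K : ℝ) ^ s ≤ Real.exp (8 * C) / (4 * C : ℝ) ^ s := by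
  have hC' : (0 : ℝ) < C := by exact_mod_cast hC
  have hCK' : 8 * (C : ℝ) ≤ K := by exact_mod_cast hCK
  have hK' : (0 : ℝ) < K := by linarith
  -- With this `x` the factor `(x * K) ^ s` is `(4 * C) ^ s`, and `8 * C ≤ K` gives `x ≤ 1 / 2`,
  -- hence `(1 - x)⁻¹ ≤ exp (2 * x)`.
  set x : ℝ := 4 * C / K with hx
  have hx0 : 0 < x := by positivity
  have hx2 : x ≤ 1 / 2 := by
    rw [hx, div_le_div_iff₀ hK' (by norm_num)]; linarith
  have hxK : x * K = 4 * C := by rw [hx]; field_simp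
  have hy : 1 ≤ (1 - x) * Real.exp (2 * x) := by
    have h := Real.add_one_le_exp (2 * x)
    nlinarith
  have hyK : 1 ≤ (1 - x) ^ K * Real.exp (8 * C) := by
    have h := one_le_pow₀ hy (n := K)
    rwa [mul_pow, ← Real.exp_nat_mul, show (K : ℝ) * (2 * x) = 8 * C by linarith] at h
  have hm := multichoose_mul_pow_le_one hx0.le (by linarith) K s
  rw [div_le_div_iff₀ (by positivity) (by positivity), ← hxK, mul_pow]
  have hm0 : (0 : ℝ) ≤ K.multichoose s * x ^ s := by positivity
  calc (K.multichoose s : ℝ) * (x ^ s * (K : ℝ) ^ s)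
      = (K.multichoose s * x ^ s) * 1 * (K : ℝ) ^ s := by ring
    _ ≤ (K.multichoose s * x ^ s) * ((1 - x) ^ K * Real.exp (8 * C)) * (K : ℝ) ^ s := by gcongr
    _ = (K.multichoose s * x ^ s * (1 - x) ^ K) * Real.exp (8 * C) * (K : ℝ) ^ s := by ring
    _ ≤ 1 * Real.exp (8 * C) * (K : ℝ) ^ s := by gcongr
    _ = _ := by ring

/-! ### Delay sequences -/

namespace LeveledPathCollection

variable {V : Type*} {G : SimpleGraph V} {n N : ℕ} [DecidableEq V]

/-- The aggregation groups that have packets whose paths cross the edge `e`. -/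
def groupsAt (P : LeveledPathCollection G n N) (e : V × V) : Finset (Fin N) :=
  (Finset.univ.filter fun i => e ∈ P.pathEdges i).image P.group

/-- The edges of `E(P)` that lead to the tail of `e`. -/
def predEdges (P : LeveledPathCollection G n N) (e : V × V) : Finset (V × V) :=
  P.edges.filter fun e' => e'.2 = e.1

/-- The lists of delaying groups of the backward traces of `t` steps that start at the edge `e`, the
latest delay first. Each step of a trace either moves on to an edge leading to the tail of the
current edge, or stays at the current edge and records a group that has packets crossing it. -/
def delaySequences (P : LeveledPathCollection G n N) : ℕ → V × V → Finset (List (Fin N))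
  | 0, _ => {[]}
  | t + 1, e => (P.predEdges e).biUnion (P.delaySequences t) ∪
      (P.groupsAt e).biUnion fun g => (P.delaySequences t e).image (g :: ·)

theorem card_groupsAt_le (P : LeveledPathCollection G n N) {e : V × V} (he : e ∈ P.edges) :
    (P.groupsAt e).card ≤ P.congestion :=
  Finset.le_sup (f := fun e => (P.groupsAt e).card) he

theorem card_predEdges_le (P : LeveledPathCollection G n N) (e : V × V) :
    (P.predEdges e).card ≤ P.degree := by
  rcases (P.predEdges e).eq_empty_or_nonempty with h | ⟨e', he'⟩
  · simp [h]
  · obtain ⟨he', h⟩ := Finset.mem_filter.1 he'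
    rw [predEdges, ← h]
    exact Finset.le_sup (f := fun e => (P.edges.filter fun e' => e'.2 = e.2).card) he'

theorem edgeAt_mem_pathEdges (P : LeveledPathCollection G n N) {i : Fin n} {k : ℕ}
    (hk : k < (P.path i).length) : P.edgeAt i k ∈ P.pathEdges i :=
  Finset.mem_image_of_mem _ (Finset.mem_range.2 hk)

theorem edgeAt_mem_edges (P : LeveledPathCollection G n N) {i : Fin n} {k : ℕ}
    (hk : k < (P.path i).length) : P.edgeAt i k ∈ P.edges :=
  Finset.mem_biUnion.2 ⟨i, Finset.mem_univ i, P.edgeAt_mem_pathEdges hk⟩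

theorem length_path_le_depth (P : LeveledPathCollection G n N) (i : Fin n) :
    (P.path i).length ≤ P.depth :=
  le_csSup P.bddAbove_directedPathLengths ⟨(P.path i).getVert, fun _ hj => P.edgeAt_mem_edges hj⟩

theorem card_edges_le (P : LeveledPathCollection G n N) : P.edges.card ≤ n * P.depth := by
  refine Finset.card_biUnion_le.trans ?_
  calc ∑ i : Fin n, (P.pathEdges i).card ≤ ∑ _i : Fin n, P.depth := by
        refine Finset.sum_le_sum fun i _ => Finset.card_image_le.trans ?_
        simpa using P.length_path_le_depth i
    _ = n * P.depth := by simp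

/-- A trace of `t` steps with `l.length` delays makes `t - l.length` moves, which extend backward
any directed path of `k` edges that begins with the edge at which the trace starts. -/
theorem add_le_length_add_depth (P : LeveledPathCollection G n N) {t k : ℕ} {v : ℕ → V}
    (hk : 0 < k) (hv : ∀ j < k, (v j, v (j + 1)) ∈ P.edges) {l : List (Fin N)}
    (hl : l ∈ P.delaySequences t (v 0, v 1)) : t + k ≤ l.length + P.depth := by
  induction t generalizing k v l with
  | zero =>
    have h : k ≤ P.depth := le_csSup P.bddAbove_directedPathLengths ⟨v, hv⟩
    omega
  | succ t ih =>
    rw [delaySequences, Finset.mem_union, Finset.mem_biUnion, Finset.mem_biUnion] at hl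
    rcases hl with ⟨e, he, hl⟩ | ⟨g, -, hl⟩
    · obtain ⟨he, he2⟩ := Finset.mem_filter.1 he
      have hE : (e.1, v 0) = e := Prod.ext rfl he2.symm
      have hpre := ih (k := k + 1) (v := fun j => j.casesOn e.1 v) k.succ_pos ?_
        (l := l) (by change l ∈ P.delaySequences t (e.1, v 0); rwa [hE])
      · omega
      · rintro (_ | j) hj
        · change (e.1, v 0) ∈ P.edges
          rwa [hE]
        · exact hv j (by omega)
    · obtain ⟨l', hl', rfl⟩ := Finset.mem_image.1 hl
      have := ih hk hv hl'
      simp only [List.length_cons]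
      omega

/-- In the recursion for the weighted number of delay sequences, the weight `d / C` makes the at most
`d` moves and the at most `C` delays contribute equally. -/
theorem sum_delaySequences_le (P : LeveledPathCollection G n N) (hC : 0 < P.congestion)
    {d : ℝ} (hd : (P.degree : ℝ) ≤ d) (t : ℕ) {e : V × V} (he : e ∈ P.edges) :
    ∑ l ∈ P.delaySequences t e, (d / P.congestion) ^ l.length ≤ (2 * d) ^ t := by
  have hC' : (0 : ℝ) < P.congestion := by exact_mod_cast hC
  have hd0 : 0 ≤ d := (Nat.cast_nonneg _).trans hd
  have hq : 0 ≤ d / P.congestion := by positivity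
  induction t generalizing e with
  | zero => simp [delaySequences]
  | succ t ih =>
    set w : List (Fin N) → ℝ := fun l => (d / P.congestion) ^ l.length with hw
    have hw0 : ∀ l, 0 ≤ w l := fun l => by positivity
    have hmove : ∑ l ∈ (P.predEdges e).biUnion (P.delaySequences t), w l ≤ d * (2 * d) ^ t := by
      refine (sum_biUnion_le_sum_sum _ _ hw0).trans ?_
      calc ∑ e' ∈ P.predEdges e, ∑ l ∈ P.delaySequences t e', w l
          ≤ ∑ _e' ∈ P.predEdges e, (2 * d) ^ t :=
            Finset.sum_le_sum fun e' he' => ih (Finset.mem_filter.1 he').1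
        _ = (P.predEdges e).card * (2 * d) ^ t := by simp
        _ ≤ d * (2 * d) ^ t := by
          gcongr
          exact le_trans (by exact_mod_cast P.card_predEdges_le e) hd
    have hdelay : ∑ l ∈ (P.groupsAt e).biUnion fun g => (P.delaySequences t e).image (g :: ·), w l
        ≤ d * (2 * d) ^ t := by
      refine (sum_biUnion_le_sum_sum _ _ hw0).trans ?_
      calc ∑ g ∈ P.groupsAt e, ∑ l ∈ (P.delaySequences t e).image (g :: ·), w l
          ≤ ∑ _g ∈ P.groupsAt e, d / P.congestion * (2 * d) ^ t := by
            refine Finset.sum_le_sum fun g _ => ?_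
            rw [Finset.sum_image fun _ _ _ _ h => (List.cons.inj h).2]
            simp only [hw, List.length_cons, pow_succ', ← Finset.mul_sum]
            exact mul_le_mul_of_nonneg_left (ih he) hq
        _ = (P.groupsAt e).card * (d / P.congestion * (2 * d) ^ t) := by simp
        _ ≤ P.congestion * (d / P.congestion * (2 * d) ^ t) := by
          gcongr
          exact P.card_groupsAt_le he
        _ = d * (2 * d) ^ t := by field_simp
    calc ∑ l ∈ P.delaySequences (t + 1) e, w l
        ≤ _ := (le_add_of_nonneg_right (Finset.sum_nonneg fun l _ => hw0 l)).trans_eq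
          (Finset.sum_union_inter)
      _ ≤ d * (2 * d) ^ t + d * (2 * d) ^ t := add_le_add hmove hdelay
      _ = (2 * d) ^ (t + 1) := by ring

/-- A delayed packet is delayed by a winning packet whose group has a strictly smaller priority. -/
theorem exists_wins_priority_lt (P : LeveledPathCollection G n N) {K : ℕ} (ρ : Fin N → Fin K)
    {s : RoutingState n} {i : Fin n} (hi : i ∈ s.alive) (hpos : s.pos i < (P.path i).length)
    (hnot : ¬ P.Wins ρ s i) :
    ∃ j, P.Wins ρ s j ∧ P.edgeAt j (s.pos j) = P.edgeAt i (s.pos i) ∧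
      priority ρ (P.group j) < priority ρ (P.group i) := by
  set e := P.edgeAt i (s.pos i) with he
  have hiW : P.Wants s i e := ⟨hi, hpos, rfl⟩
  obtain ⟨j, hj, hmin⟩ := Finset.exists_min_image (Finset.univ.filter fun j => P.Wants s j e)
    (fun j => priority ρ (P.group j)) ⟨i, by simpa using hiW⟩
  simp only [Finset.mem_filter, Finset.mem_univ, true_and] at hj hmin
  have hje : P.edgeAt j (s.pos j) = e := hj.2.2
  refine ⟨j, ⟨hje ▸ hj, fun k hk => ?_⟩, hje, ?_⟩
  · exact Prod.Lex.toLex_le_toLex.1 (hmin k (hje ▸ hk))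
  · by_contra hlt
    exact hnot ⟨hiW, fun k hk => Prod.Lex.toLex_le_toLex.1 ((not_lt.1 hlt).trans (hmin k hk))⟩

/-- The backward trace of a packet that crosses an edge in step `t`. The group of the packet itself is
put in front of the list so that the priorities can be compared with it in the induction. -/
theorem exists_delaySequence (P : LeveledPathCollection G n N) {K : ℕ} (ρ : Fin N → Fin K)
    (R : CombineRule n) (t : ℕ) {i : Fin n}
    (hi : P.Wins ρ (P.combine R t (P.run ρ R t)) i) :
    ∃ l ∈ P.delaySequences t (P.edgeAt i ((P.run ρ R t).pos i)),
      (P.group i :: l).Pairwise fun a b => priority ρ b < priority ρ a := by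
  induction t generalizing i with
  | zero => exact ⟨[], by simp [delaySequences], by simp⟩
  | succ t ih =>
    set s := P.combine R t (P.run ρ R t) with hs
    have hrun : P.run ρ R (t + 1) = P.forward ρ s := rfl
    have halive : i ∈ s.alive := (Finset.mem_filter.1 hi.1.1).1
    have hlen : (P.run ρ R (t + 1)).pos i < (P.path i).length := hi.1.2.1
    by_cases hw : P.Wins ρ s i
    · obtain ⟨l, hl, hp⟩ := ih hw
      have hpos : (P.run ρ R (t + 1)).pos i = (P.run ρ R t).pos i + 1 := if_pos hw
      refine ⟨l, ?_, hp⟩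
      rw [delaySequences, Finset.mem_union, Finset.mem_biUnion]
      refine Or.inl ⟨_, Finset.mem_filter.2 ⟨P.edgeAt_mem_edges hw.1.2.1, ?_⟩, hl⟩
      rw [hpos]
      rfl
    · have hpos : (P.run ρ R (t + 1)).pos i = s.pos i := if_neg hw
      rw [hpos] at hlen ⊢
      obtain ⟨j, hj, hje, hlt⟩ := P.exists_wins_priority_lt ρ halive hlen hw
      obtain ⟨l, hl, hp⟩ := ih hj
      refine ⟨P.group j :: l, ?_, ?_⟩
      · rw [delaySequences, Finset.mem_union, Finset.mem_biUnion, Finset.mem_biUnion]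
        refine Or.inr ⟨P.group j, Finset.mem_image_of_mem _ (Finset.mem_filter.2
          ⟨Finset.mem_univ j, ?_⟩), Finset.mem_image_of_mem _ (hje ▸ hl)⟩
        exact hje ▸ P.edgeAt_mem_pathEdges hj.1.2.1
      · refine List.pairwise_cons.2 ⟨fun b hb => ?_, hp⟩
        rcases List.mem_cons.1 hb with rfl | hb
        · exact hlt
        · exact ((List.pairwise_cons.1 hp).1 b hb).trans hlt

theorem pos_run_le (P : LeveledPathCollection G n N) {K : ℕ} (ρ : Fin N → Fin K)
    (R : CombineRule n) (t : ℕ) (i : Fin n) : (P.run ρ R t).pos i ≤ (P.path i).length := by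
  induction t with
  | zero => exact Nat.zero_le _
  | succ t ih =>
    by_cases hw : P.Wins ρ (P.combine R t (P.run ρ R t)) i
    · have hpos : (P.run ρ R (t + 1)).pos i = (P.run ρ R t).pos i + 1 := if_pos hw
      rw [hpos]
      exact hw.1.2.1
    · have hpos : (P.run ρ R (t + 1)).pos i = (P.run ρ R t).pos i := if_neg hw
      rwa [hpos]

theorem exists_delaySequence_of_not_finished (P : LeveledPathCollection G n N) {K : ℕ}
    (ρ : Fin N → Fin K) (R : CombineRule n) (t : ℕ)
    (h : ¬ P.Finished (P.run ρ R (t + 1))) :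
    ∃ e ∈ P.edges, ∃ l ∈ P.delaySequences t e,
      l.Pairwise fun a b => priority ρ b < priority ρ a := by
  obtain ⟨i, hi, hne⟩ : ∃ i ∈ (P.run ρ R (t + 1)).alive,
      (P.run ρ R (t + 1)).pos i ≠ (P.path i).length := by
    simpa [Finished] using h
  have hlt := lt_of_le_of_ne (P.pos_run_le ρ R (t + 1) i) hne
  obtain ⟨j, hj⟩ : ∃ j, P.Wins ρ (P.combine R t (P.run ρ R t)) j := by
    by_cases hw : P.Wins ρ (P.combine R t (P.run ρ R t)) i
    · exact ⟨i, hw⟩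
    · have hpos : (P.run ρ R (t + 1)).pos i = (P.run ρ R t).pos i := if_neg hw
      rw [hpos] at hlt
      obtain ⟨j, hj, -⟩ := P.exists_wins_priority_lt ρ (s := P.combine R t (P.run ρ R t)) hi hlt hw
      exact ⟨j, hj⟩
  obtain ⟨l, hl, hp⟩ := P.exists_delaySequence ρ R t hj
  exact ⟨_, P.edgeAt_mem_edges hj.1.2.1, l, hl, (List.pairwise_cons.1 hp).2⟩

/-! ### The failure probability -/

/-- The union bound over all last edges and all delay sequences. The choices of the combining rule
cost nothing, since the delay sequences do not depend on them. -/
theorem uniformOn_not_finished_le (P : LeveledPathCollection G n N) {K : ℕ} (hK : 0 < K)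
    (hCK : 8 * P.congestion ≤ K) (t : ℕ) :
    (ProbabilityTheory.uniformOn (Set.univ : Set (Fin N → Fin K))).real
        {ρ | ∃ R : CombineRule n, ¬ P.Finished (P.run ρ R (t + 1))} ≤
      n * P.depth * (Real.exp (8 * P.congestion) *
        (4 * max (P.degree : ℝ) 2) ^ P.depth / 2 ^ t) := by
  set d : ℝ := max (P.degree : ℝ) 2 with hd
  have hd2 : 2 ≤ d := le_max_right _ _
  have := isProbabilityMeasure_uniformOn_ranks (N := N) hK
  set μ := ProbabilityTheory.uniformOn (Set.univ : Set (Fin N → Fin K)) with hμ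
  let A : List (Fin N) → Set (Fin N → Fin K) := fun l =>
    {ρ | l.Pairwise fun a b => priority ρ b < priority ρ a}
  have hedge : ∀ e ∈ P.edges, μ.real (⋃ l ∈ P.delaySequences t e, A l) ≤
      Real.exp (8 * P.congestion) * (4 * d) ^ P.depth / 2 ^ t := by
    intro e he
    have hC : 0 < P.congestion := by
      obtain ⟨i, -, hi⟩ := Finset.mem_biUnion.1 he
      refine lt_of_lt_of_le (Finset.card_pos.2 ⟨P.group i, ?_⟩) (P.card_groupsAt_le he)
      exact Finset.mem_image_of_mem _ (by simpa using hi)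
    have hC' : (0 : ℝ) < P.congestion := by exact_mod_cast hC
    have hterm : ∀ l ∈ P.delaySequences t e, μ.real (A l) ≤
        Real.exp (8 * P.congestion) * (4 * d) ^ P.depth / (4 * d) ^ t *
          (d / P.congestion) ^ l.length := by
      intro l hl
      refine ((uniformOn_univ_real_pairwise_le hK l).trans
        (multichoose_div_pow_le hC hCK l.length)).trans ?_
      have hlen : t ≤ l.length + P.depth := by
        have := P.add_le_length_add_depth (t := t) (k := 1)
          (v := fun j => j.casesOn e.1 fun _ => e.2) one_pos
          (by intro j hj; obtain rfl : j = 0 := by omega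
              exact he) hl
        omega
      have hpow : (4 * d) ^ t ≤ (4 * d) ^ l.length * (4 * d) ^ P.depth := by
        rw [← pow_add]
        exact pow_le_pow_right₀ (by linarith) hlen
      rw [div_pow, div_mul_div_comm, div_le_div_iff₀ (by positivity) (by positivity)]
      calc Real.exp (8 * P.congestion) * ((4 * d) ^ t * (P.congestion : ℝ) ^ l.length)
          ≤ Real.exp (8 * P.congestion) * ((4 * d) ^ l.length * (4 * d) ^ P.depth *
            (P.congestion : ℝ) ^ l.length) := by gcongr
        _ = _ := by rw [mul_pow, mul_pow 4 (P.congestion : ℝ)]; ring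
    refine (MeasureTheory.measureReal_biUnion_finset_le _ _).trans
      ((Finset.sum_le_sum hterm).trans ?_)
    rw [← Finset.mul_sum]
    refine (mul_le_mul_of_nonneg_left
      (P.sum_delaySequences_le hC (d := d) (le_max_left _ _) t he) (by positivity)).trans_eq ?_
    rw [show 4 * d = 2 * (2 * d) by ring, mul_pow 2 (2 * d) t]
    field_simp
  calc μ.real {ρ | ∃ R : CombineRule n, ¬ P.Finished (P.run ρ R (t + 1))}
      ≤ μ.real (⋃ e ∈ P.edges, ⋃ l ∈ P.delaySequences t e, A l) := by
        refine MeasureTheory.measureReal_mono ?_ (MeasureTheory.measure_ne_top _ _)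
        rintro ρ ⟨R, h⟩
        obtain ⟨e, he, l, hl, hp⟩ := P.exists_delaySequence_of_not_finished ρ R t h
        simp only [Set.mem_iUnion]
        exact ⟨e, he, l, hl, hp⟩
    _ ≤ ∑ e ∈ P.edges, μ.real (⋃ l ∈ P.delaySequences t e, A l) :=
        MeasureTheory.measureReal_biUnion_finset_le _ _
    _ ≤ P.edges.card * (Real.exp (8 * P.congestion) * (4 * d) ^ P.depth / 2 ^ t) := by
        refine (Finset.sum_le_sum hedge).trans_eq ?_
        rw [Finset.sum_const, nsmul_eq_mul]
    _ ≤ _ := by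
        gcongr
        exact_mod_cast P.card_edges_le

end LeveledPathCollection

theorem mainTheorem11 :
    ∀ c : ℝ, 0 < c → ∃ B : ℝ, 0 < B ∧
      ∀ (V : Type*) [DecidableEq V] (G : SimpleGraph V) (n N K : ℕ)
        (P : LeveledPathCollection G n N),
        0 < K → 8 * P.congestion ≤ K →
          1 - 1 / (n : ℝ) ^ c ≤
            (ProbabilityTheory.uniformOn (Set.univ : Set (Fin N → Fin K))).real
              {ρ | ∀ R : CombineRule n, ∃ T : ℕ,
                (T : ℝ) ≤ B * ((P.congestion : ℝ) +
                  (P.depth : ℝ) * Real.log (max (P.degree : ℝ) 2) + Real.log (n : ℝ)) ∧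
                P.Finished (P.run ρ R T)} := by
  intro c hc
  have hlog2 : 0 < Real.log 2 := Real.log_pos one_lt_two
  refine ⟨(c + 11) / Real.log 2, by positivity, ?_⟩
  intro V _ G n N K P hK hCK
  have := isProbabilityMeasure_uniformOn_ranks (N := N) hK
  -- For `n = 0` the quotient `1 / 0 ^ c` is `0`, so the event has to be certain; it is, since there
  -- are no packets. For `n = 1` there is nothing to prove.
  rcases Nat.eq_zero_or_pos n with rfl | hn
  · have huniv : {ρ : Fin N → Fin K | ∀ R : CombineRule 0, ∃ T : ℕ,
        (T : ℝ) ≤ (c + 11) / Real.log 2 * ((P.congestion : ℝ) +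
          (P.depth : ℝ) * Real.log (max (P.degree : ℝ) 2) + Real.log ((0 : ℕ) : ℝ)) ∧
        P.Finished (P.run ρ R T)} = Set.univ := by
      refine Set.eq_univ_of_forall fun ρ R => ⟨0, ?_, fun i => i.elim0⟩
      have : 0 ≤ Real.log (max (P.degree : ℝ) 2) :=
        Real.log_nonneg (one_le_two.trans (le_max_right _ _))
      simp only [Nat.cast_zero, Real.log_zero]
      positivity
    rw [huniv, MeasureTheory.probReal_univ]
    simp [Real.zero_rpow hc.ne']
  rcases Nat.lt_or_ge n 2 with hn1 | hn2
  · obtain rfl : n = 1 := by omega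
    simp
  have hnR : (2 : ℝ) ≤ n := by exact_mod_cast hn2
  set d : ℝ := max (P.degree : ℝ) 2 with hd
  have hd2 : 2 ≤ d := le_max_right _ _
  have hlogd : Real.log 2 ≤ Real.log d := Real.log_le_log two_pos hd2
  have hlogn : Real.log 2 ≤ Real.log n := Real.log_le_log two_pos hnR
  set X : ℝ := (P.congestion : ℝ) + (P.depth : ℝ) * Real.log d + Real.log (n : ℝ) with hX
  have hDd : 0 ≤ (P.depth : ℝ) * Real.log d := by
    have := hlog2.le.trans hlogd
    positivity
  have hC0 : (0 : ℝ) ≤ P.congestion := Nat.cast_nonneg _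
  have hX2 : Real.log 2 ≤ X := by linarith
  -- Of the constant `c + 11`, the summand `2` pays for rounding down to `T = t + 1` and for
  -- passing from `T` to `t`, `c + 1` for the
  -- factors `n ^ c` and `n`, and `8` for `exp (8 * C)` and for `(8 * d) ^ D ≤ d ^ (4 * D)`.
  have hBX : 1 ≤ (c + 11) / Real.log 2 * X := by
    rw [div_mul_eq_mul_div, le_div_iff₀ hlog2]
    nlinarith
  obtain ⟨t, ht⟩ : ∃ t, ⌊(c + 11) / Real.log 2 * X⌋₊ = t + 1 :=
    Nat.exists_eq_succ_of_ne_zero (Nat.floor_pos.2 hBX).ne'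
  have htle : ((t + 1 : ℕ) : ℝ) ≤ (c + 11) / Real.log 2 * X :=
    ht ▸ Nat.floor_le (by linarith)
  have htge : (c + 9) * X ≤ t * Real.log 2 := by
    have h1 : (c + 11) / Real.log 2 * X < (t : ℝ) + 2 := by
      have := Nat.lt_floor_add_one ((c + 11) / Real.log 2 * X)
      rw [ht] at this
      push_cast at this
      linarith
    rw [div_mul_eq_mul_div, div_lt_iff₀ hlog2] at h1
    linarith
  set bad : Set (Fin N → Fin K) :=
    {ρ | ∃ R : CombineRule n, ¬ P.Finished (P.run ρ R (t + 1))} with hbad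
  have hprob : (ProbabilityTheory.uniformOn (Set.univ : Set (Fin N → Fin K))).real bad ≤
      1 / (n : ℝ) ^ c := by
    refine (P.uniformOn_not_finished_le hK hCK t).trans ?_
    have hn0 : (0 : ℝ) < n := by linarith
    have hd0 : 0 < d := by linarith
    have hD : (P.depth : ℝ) ≤ 2 ^ P.depth := by exact_mod_cast Nat.lt_two_pow_self.le
    have h4d : 2 ^ P.depth * (4 * d) ^ P.depth ≤ Real.exp (4 * (P.depth * Real.log d)) := by
      rw [← mul_pow, show 4 * (P.depth * Real.log d) = P.depth * (4 * Real.log d) by ring,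
        Real.exp_nat_mul]
      have : Real.exp (4 * Real.log d) = d ^ 4 := by
        rw [show (4 : ℝ) = (4 : ℕ) by norm_num, Real.exp_nat_mul, Real.exp_log hd0]
      rw [this]
      gcongr
      have h8 : (2 : ℝ) ^ 3 ≤ d ^ 3 := by gcongr
      nlinarith
    have h2t : (2 : ℝ) ^ t = Real.exp (t * Real.log 2) := by
      rw [Real.exp_nat_mul, Real.exp_log two_pos]
    calc (n : ℝ) * P.depth * (Real.exp (8 * P.congestion) * (4 * d) ^ P.depth / 2 ^ t)
        ≤ n * 2 ^ P.depth * (Real.exp (8 * P.congestion) * (4 * d) ^ P.depth / 2 ^ t) := by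
          gcongr
      _ = n * Real.exp (8 * P.congestion) * (2 ^ P.depth * (4 * d) ^ P.depth) / 2 ^ t := by ring
      _ ≤ n * Real.exp (8 * P.congestion) * Real.exp (4 * (P.depth * Real.log d)) / 2 ^ t := by
          gcongr
      _ = Real.exp (Real.log n + 8 * P.congestion + 4 * (P.depth * Real.log d)
            - t * Real.log 2) := by
          rw [h2t, Real.exp_sub, Real.exp_add, Real.exp_add, Real.exp_log hn0]
      _ ≤ Real.exp (-(Real.log n * c)) := by
          refine Real.exp_le_exp.2 ?_
          have h1 : c * Real.log n ≤ c * X := mul_le_mul_of_nonneg_left (by linarith) hc.le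
          nlinarith
      _ = 1 / (n : ℝ) ^ c := by
          rw [Real.rpow_def_of_pos hn0, Real.exp_neg, one_div]
  have hcompl : badᶜ ⊆ {ρ | ∀ R : CombineRule n, ∃ T : ℕ,
      (T : ℝ) ≤ (c + 11) / Real.log 2 * X ∧ P.Finished (P.run ρ R T)} := by
    intro ρ hρ R
    exact ⟨t + 1, htle, not_not.1 fun h => hρ ⟨R, h⟩⟩
  refine le_trans ?_ (MeasureTheory.measureReal_mono hcompl)
  rw [MeasureTheory.probReal_compl_eq_one_sub (Set.toFinite bad).measurableSet]
  linarith
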